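/- Let $q$ be a complex number with $0<|q|<1$. Write $(a;q)_n=\prod_{k=0}^{n-1}(1-aq^k)$ for $n\ge 0$, $\begin{bmatrix}m\\n\end{bmatrix}_q=\dfrac{(q;q)_m}{(q;q)_n(q;q)_{m-n}}$ for $0\le n\le m$, and let $\theta(z;q)=\sum_{k=0}^{\infty}(-1)^kq^{k(k-1)/2}z^k$ be the partial theta function. Then for every integer $m\ge 1$, the series $\theta(q^{2n-2m+1};q^2)$, $0\le n\le m$, converge absolutely and $$\sum_{n=0}^{m}\frac{(-1;q)_n}{(-q^{1-m};q)_n}\begin{bmatrix}m\\n\end{bmatrix}_q q^{3n^2/2+n/2-2nm} =\sum_{n=0}^{m}\frac{(-1;q)_n}{(-q^{1-m};q)_n}\begin{bmatrix}m\\n\end{bmatrix}_q q^{3n^2/2-n/2-2nm}\bigl(1+q^n+q^{n-m}-q^{2n-m}\bigr)\,\theta(q^{2n-2m+1};q^2).$$ -/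

import Mathlib

/-- The `q`-shifted factorial `(z; q)_n = ∏_{k < n} (1 - z q^k)`. -/
noncomputable def qPoch (z q : ℂ) (n : ℕ) : ℂ :=
  ∏ k ∈ Finset.range n, (1 - z * q ^ k)

/-- The infinite `q`-shifted factorial `(z; q)_∞ = ∏_{k ≥ 0} (1 - z q^k)`, for `|q| < 1`. -/
noncomputable def qPochInf (z q : ℂ) : ℂ :=
  ∏' k : ℕ, (1 - z * q ^ k)

/-- For `|q| < 1` the finite product agrees with the quotient `(z; q)_∞ / (z q^n; q)_∞`
whenever the denominator does not vanish. -/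
theorem qPoch_eq_div (z q : ℂ) (hq : ‖q‖ < 1) (n : ℕ) (h : qPochInf (z * q ^ n) q ≠ 0) :
    qPoch z q n = qPochInf z q / qPochInf (z * q ^ n) q := by
  rw [eq_div_iff h]
  have hm : Multipliable fun k : ℕ => (1 - z * q ^ (k + n)) := by
    have hs : Summable fun k : ℕ => ‖-(z * q ^ (k + n))‖ := by
      have h1 := (summable_geometric_of_lt_one (norm_nonneg q) hq).mul_left (‖z‖ * ‖q‖ ^ n)
      refine h1.congr fun k => ?_
      rw [norm_neg, norm_mul, norm_pow, pow_add]
      ring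
    simpa [sub_eq_add_neg] using multipliable_one_add_of_summable hs
  have h2 := Multipliable.prod_mul_tprod_nat_mul' (f := fun k : ℕ => 1 - z * q ^ k) hm
  rw [qPochInf, qPochInf, qPoch, ← h2]
  congr 1
  refine tprod_congr fun k => ?_
  rw [pow_add]
  ring

/-- The `q`-binomial coefficient `(q; q)_m / ((q; q)_n (q; q)_{m - n})`, which is `0` for `n > m`
(`q` is not a root of unity where it is used). -/
noncomputable def qBinom (q : ℂ) (m n : ℕ) : ℂ :=
  if n ≤ m then qPoch q q m / (qPoch q q n * qPoch q q (m - n)) else 0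

/-- The `n`-th term `(-1)^n q^{n(n-1)/2} z^n` of the partial theta series. -/
noncomputable def partialThetaTerm (z q : ℂ) (n : ℕ) : ℂ :=
  (-1) ^ n * q ^ (n * (n - 1) / 2) * z ^ n

/-- The partial theta function `θ(z; q) = ∑_{n ≥ 0} (-1)^n q^{n(n-1)/2} z^n`. -/
noncomputable def partialTheta (z q : ℂ) : ℂ :=
  ∑' n : ℕ, partialThetaTerm z q n

/-!
Write `x = q ^ n`, `Q = q ^ m` and `a n = (-1; q)_n / (q; q)_n`. Reversing the product
`(-q^{1-m}; q)_n` shows that the left-hand summand is `(q; q)_m / (-1; q)_m` times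
`b n = a n * a (m - n) * q ^ (n² - nm)` (`summand_eq_thetaWeight`), a weight symmetric under
`n ↦ m - n`; the right-hand summand is the same weight times
`x⁻¹ (1 + x + x / Q - x² / Q) T n` with `T n = θ(q^{2n-2m+1}; q²)`.

The partial theta function satisfies `θ(z; q) = 1 - z θ(zq; q)`, hence
`T n = 1 - (q x² / Q²) T (n + 1)`. Together with `a (n + 1) (1 - q^{n+1}) = a n (1 + q^n)` this gives,
for `g n = b n (1 - x) (1 + Q / x)`,
`(1 - Q) (Q / x) (1 + x + x / Q - x² / Q) b n T n`
`  = g n T n - g (n + 1) T (n + 1) + Q b n (1 + x) (1 - Q / x)`.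
The `T`-terms telescope (`g 0 = 0`, and the last term closes up by itself), and since
`(1 + x) (1 - Q / x) = (1 - Q) + (x - Q / x)`, what remains is `Q (1 - Q) ∑ b n` plus
`Q ∑ b n (x - Q / x)`. The latter sum vanishes because its terms are antisymmetric under `n ↦ m - n`.
Dividing by `Q (1 - Q) ≠ 0` yields the identity.
-/

theorem partialThetaTerm_succ (z q : ℂ) (n : ℕ) :
    partialThetaTerm z q (n + 1) = -z * q ^ n * partialThetaTerm z q n := by
  have h : (n + 1) * (n + 1 - 1) / 2 = n * (n - 1) / 2 + n := by
    rw [← Nat.choose_two_right, ← Nat.choose_two_right, Nat.choose_succ_succ' n 1,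
      Nat.choose_one_right, add_comm]
  rw [partialThetaTerm, partialThetaTerm, h]
  ring

theorem partialThetaTerm_succ' (z q : ℂ) (n : ℕ) :
    partialThetaTerm z q (n + 1) = -z * partialThetaTerm (z * q) q n := by
  induction n with
  | zero => simp [partialThetaTerm]
  | succ n ih =>
    rw [partialThetaTerm_succ, ih, partialThetaTerm_succ (z * q)]
    ring

theorem summable_partialThetaTerm (z q : ℂ) (hq : ‖q‖ < 1) :
    Summable (partialThetaTerm z q) := by
  have ht : Filter.Tendsto (fun n : ℕ => ‖z‖ * ‖q‖ ^ n) Filter.atTop (nhds 0) := by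
    simpa using (tendsto_pow_atTop_nhds_zero_of_lt_one (norm_nonneg q) hq).const_mul ‖z‖
  refine summable_of_ratio_norm_eventually_le (r := 1 / 2) (by norm_num) ?_
  filter_upwards [ht.eventually (gt_mem_nhds (show (0 : ℝ) < 1 / 2 by norm_num))] with n hn
  rw [partialThetaTerm_succ, norm_mul, norm_mul, norm_neg, norm_pow]
  gcongr

theorem partialTheta_eq_one_sub (z q : ℂ) (hq : ‖q‖ < 1) :
    partialTheta z q = 1 - z * partialTheta (z * q) q := by
  rw [partialTheta, (summable_partialThetaTerm z q hq).tsum_eq_zero_add]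
  simp_rw [partialThetaTerm_succ']
  rw [tsum_mul_left, partialTheta]
  simp [partialThetaTerm]
  ring

theorem qPoch_succ (z q : ℂ) (n : ℕ) : qPoch z q (n + 1) = qPoch z q n * (1 - z * q ^ n) :=
  Finset.prod_range_succ _ _

theorem one_sub_pow_succ_ne_zero {q : ℂ} (hq : ‖q‖ < 1) (n : ℕ) : 1 - q ^ (n + 1) ≠ 0 := by
  intro h
  have h1 : ‖q ^ (n + 1)‖ = 1 := by rw [← sub_eq_zero.mp h, norm_one]
  rw [norm_pow] at h1
  exact absurd h1 (pow_lt_one₀ (norm_nonneg q) hq n.succ_ne_zero).ne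

theorem one_add_pow_ne_zero {q : ℂ} (hq : ‖q‖ < 1) (n : ℕ) : 1 + q ^ n ≠ 0 := by
  rcases n with _ | n
  · norm_num
  intro h
  have h1 : ‖q ^ (n + 1)‖ = 1 := by rw [← neg_eq_of_add_eq_zero_right h, norm_neg, norm_one]
  rw [norm_pow] at h1
  exact absurd h1 (pow_lt_one₀ (norm_nonneg q) hq n.succ_ne_zero).ne

theorem qPoch_self_ne_zero {q : ℂ} (hq : ‖q‖ < 1) (n : ℕ) : qPoch q q n ≠ 0 := by
  refine Finset.prod_ne_zero_iff.mpr fun k _ => ?_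
  simpa [pow_succ'] using one_sub_pow_succ_ne_zero hq k

theorem qPoch_neg_one_ne_zero {q : ℂ} (hq : ‖q‖ < 1) (n : ℕ) : qPoch (-1) q n ≠ 0 := by
  refine Finset.prod_ne_zero_iff.mpr fun k _ => ?_
  simpa using one_add_pow_ne_zero hq k

/-- The product `(-q^{1-m}; q)_n` written backwards, in division-free form. -/
theorem qPoch_reverse {q : ℂ} (hq0 : q ≠ 0) (m n : ℕ) (hn : n ≤ m) :
    qPoch (-q ^ (1 - (m : ℤ))) q n * qPoch (-1) q (m - n)
      = qPoch (-1) q m * q ^ ((n : ℤ) * (n + 1) / 2 - n * m) := by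
  induction n with
  | zero => simp [qPoch]
  | succ n ih =>
    have ih := ih (by omega)
    obtain ⟨k, rfl⟩ : ∃ k, m = n + 1 + k := ⟨m - (n + 1), by omega⟩
    have h1 : n + 1 + k - n = k + 1 := by omega
    have h2 : n + 1 + k - (n + 1) = k := by omega
    have h3 : ((n : ℤ) + 1) * (n + 1 + 1) / 2 = (n : ℤ) * (n + 1) / 2 + (n + 1) := by
      rw [show ((n : ℤ) + 1) * (n + 1 + 1) = (n : ℤ) * (n + 1) + (n + 1) * 2 by ring,
        Int.add_mul_ediv_right _ _ two_ne_zero]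
    rw [h1, qPoch_succ (-1)] at ih
    rw [h2, qPoch_succ]
    have h4 : q ^ (1 - ((n + 1 + k : ℕ) : ℤ)) * q ^ n = q ^ (-(k : ℤ)) := by
      rw [← zpow_natCast q n, ← zpow_add₀ hq0]
      congr 1
      push_cast
      ring
    have h5 : q ^ (((n + 1 : ℕ) : ℤ) * ((n + 1 : ℕ) + 1) / 2
          - ((n + 1 : ℕ) : ℤ) * ((n + 1 + k : ℕ) : ℤ))
        = q ^ ((n : ℤ) * (n + 1) / 2 - n * ((n + 1 + k : ℕ) : ℤ)) * q ^ (-(k : ℤ)) := by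
      rw [← zpow_add₀ hq0]
      congr 1
      push_cast
      rw [h3]
      ring
    have h6 : q ^ (-(k : ℤ)) * q ^ k = 1 := by
      rw [zpow_neg, zpow_natCast, inv_mul_cancel₀ (pow_ne_zero _ hq0)]
    rw [h5, ← mul_assoc, ← ih, neg_mul, h4]
    linear_combination (-qPoch (-q ^ (1 - ((n + 1 + k : ℕ) : ℤ))) q n * qPoch (-1) q k) * h6

/-- The ratio `(-1; q)_n / (q; q)_n`, the `n`-th Taylor coefficient of
`(-z; q)_∞ / (z; q)_∞`. -/
noncomputable def qPochRatio (q : ℂ) (n : ℕ) : ℂ :=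
  qPoch (-1) q n / qPoch q q n

theorem qPochRatio_succ {q : ℂ} (hq : ‖q‖ < 1) (n : ℕ) :
    qPochRatio q (n + 1) * (1 - q ^ (n + 1)) = qPochRatio q n * (1 + q ^ n) := by
  have h1 := one_sub_pow_succ_ne_zero hq n
  have h2 := qPoch_self_ne_zero hq n
  have h3 : 1 - q * q ^ n = 1 - q ^ (n + 1) := by ring
  rw [qPochRatio, qPochRatio, qPoch_succ, qPoch_succ, h3]
  field_simp
  ring

/-- The weight `a n * a (m - n) * q ^ (n² - nm)`, where `a n = (-1; q)_n / (q; q)_n`. It is the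
left-hand summand up to a factor depending on `m` only. -/
noncomputable def thetaWeight (q : ℂ) (m n : ℕ) : ℂ :=
  qPochRatio q n * qPochRatio q (m - n) * q ^ ((n : ℤ) ^ 2 - n * m)

theorem thetaWeight_reflect (q : ℂ) {m n : ℕ} (hn : n ≤ m) :
    thetaWeight q m (m - n) = thetaWeight q m n := by
  rw [thetaWeight, thetaWeight, Nat.sub_sub_self hn, Nat.cast_sub hn,
    mul_comm (qPochRatio q (m - n))]
  congr 2
  ring

theorem thetaWeight_succ {q : ℂ} (hq0 : q ≠ 0) (hq : ‖q‖ < 1) {m n : ℕ} (hn : n < m) :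
    thetaWeight q m (n + 1) * (1 - q ^ (n + 1)) * (1 + q ^ m / q ^ (n + 1)) * q ^ m
      = thetaWeight q m n * (1 + q ^ n) * (1 - q ^ m / q ^ n) * (q * (q ^ n) ^ 2) := by
  obtain ⟨k, rfl⟩ : ∃ k, m = n + 1 + k := ⟨m - (n + 1), by omega⟩
  have h1 : n + 1 + k - n = k + 1 := by omega
  have h2 : n + 1 + k - (n + 1) = k := by omega
  have h3 : q ^ (n + 1 + k) / q ^ (n + 1) = q ^ k := by
    rw [pow_add _ (n + 1), mul_div_cancel_left₀ _ (pow_ne_zero _ hq0)]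
  have h4 : q ^ (n + 1 + k) / q ^ n = q ^ (k + 1) := by
    rw [add_assoc, add_comm 1, pow_add _ n, mul_div_cancel_left₀ _ (pow_ne_zero _ hq0)]
  have h5 : q ^ (((n + 1 : ℕ) : ℤ) ^ 2 - ((n + 1 : ℕ) : ℤ) * ((n + 1 + k : ℕ) : ℤ))
      * q ^ (n + 1 + k)
      = q ^ ((n : ℤ) ^ 2 - (n : ℤ) * ((n + 1 + k : ℕ) : ℤ)) * (q * (q ^ n) ^ 2) := by
    have h6 : q * (q ^ n) ^ 2 = q ^ (1 + n * 2) := by ring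
    rw [h6, ← zpow_natCast q (n + 1 + k), ← zpow_natCast q (1 + n * 2), ← zpow_add₀ hq0,
      ← zpow_add₀ hq0]
    congr 1
    push_cast
    ring
  rw [thetaWeight, thetaWeight, h1, h2, h3, h4]
  set e := q ^ (((n + 1 : ℕ) : ℤ) ^ 2 - ((n + 1 : ℕ) : ℤ) * ((n + 1 + k : ℕ) : ℤ))
  set f := q ^ ((n : ℤ) ^ 2 - (n : ℤ) * ((n + 1 + k : ℕ) : ℤ))
  calc _ = (qPochRatio q (n + 1) * (1 - q ^ (n + 1))) * (qPochRatio q k * (1 + q ^ k))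
          * (e * q ^ (n + 1 + k)) := by ring
    _ = _ := by rw [qPochRatio_succ hq, ← qPochRatio_succ hq k, h5]; ring

theorem three_mul_sq_add_self_ediv_two (n : ℤ) :
    (3 * n ^ 2 + n) / 2 = n ^ 2 + n * (n + 1) / 2 := by
  rw [show 3 * n ^ 2 + n = n * (n + 1) + n ^ 2 * 2 by ring,
    Int.add_mul_ediv_right _ _ two_ne_zero, add_comm]

theorem three_mul_sq_sub_self_ediv_two (n : ℤ) :
    (3 * n ^ 2 - n) / 2 = n ^ 2 + n * (n + 1) / 2 - n := by
  rw [show 3 * n ^ 2 - n = n * (n + 1) + (n ^ 2 - n) * 2 by ring,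
    Int.add_mul_ediv_right _ _ two_ne_zero]
  ring

theorem summand_eq_thetaWeight {q : ℂ} (hq0 : q ≠ 0) (hq : ‖q‖ < 1) {m n : ℕ} (hn : n ≤ m) :
    qPoch (-1) q n / qPoch (-q ^ (1 - (m : ℤ))) q n * qBinom q m n
        * q ^ ((3 * (n : ℤ) ^ 2 + (n : ℤ)) / 2 - 2 * (n : ℤ) * (m : ℤ))
      = qPoch q q m / qPoch (-1) q m * thetaWeight q m n := by
  have hrev := qPoch_reverse hq0 m n hn
  have hm := qPoch_neg_one_ne_zero hq m
  have hmn := qPoch_neg_one_ne_zero hq (m - n)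
  have hden : qPoch (-q ^ (1 - (m : ℤ))) q n ≠ 0 := by
    intro h
    rw [h, zero_mul] at hrev
    exact mul_ne_zero hm (zpow_ne_zero _ hq0) hrev.symm
  have h1 := qPoch_self_ne_zero hq n
  have h2 := qPoch_self_ne_zero hq (m - n)
  have hexp : q ^ ((3 * (n : ℤ) ^ 2 + (n : ℤ)) / 2 - 2 * (n : ℤ) * (m : ℤ))
      = q ^ ((n : ℤ) * (n + 1) / 2 - n * m) * q ^ ((n : ℤ) ^ 2 - n * m) := by
    rw [three_mul_sq_add_self_ediv_two, ← zpow_add₀ hq0]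
    congr 1
    ring
  rw [qBinom, if_pos hn, hexp, thetaWeight, qPochRatio, qPochRatio]
  set e := q ^ ((n : ℤ) * (n + 1) / 2 - n * m)
  set f := q ^ ((n : ℤ) ^ 2 - n * m)
  field_simp
  linear_combination (-(qPoch (-1) q n * qPoch q q m * f)) * hrev

theorem sum_thetaWeight_antisymm {q : ℂ} (hq0 : q ≠ 0) (m : ℕ) :
    ∑ n ∈ Finset.range (m + 1), thetaWeight q m n * (q ^ n - q ^ m / q ^ n) = 0 := by
  have h := Finset.sum_range_reflect
    (fun n => thetaWeight q m n * (q ^ n - q ^ m / q ^ n)) (m + 1)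
  have h' : ∑ n ∈ Finset.range (m + 1),
      thetaWeight q m (m + 1 - 1 - n) * (q ^ (m + 1 - 1 - n) - q ^ m / q ^ (m + 1 - 1 - n))
      = -∑ n ∈ Finset.range (m + 1), thetaWeight q m n * (q ^ n - q ^ m / q ^ n) := by
    rw [← Finset.sum_neg_distrib]
    refine Finset.sum_congr rfl fun n hn => ?_
    have hn : n ≤ m := Finset.mem_range_succ_iff.mp hn
    have h1 : q ^ m = q ^ (m - n) * q ^ n := by rw [← pow_add, Nat.sub_add_cancel hn]
    rw [Nat.add_sub_cancel, thetaWeight_reflect q hn, h1,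
      mul_div_cancel_right₀ _ (pow_ne_zero _ hq0), mul_div_cancel_left₀ _ (pow_ne_zero _ hq0)]
    ring
  rw [h'] at h
  exact self_eq_neg.mp h.symm

/-- The telescoped form of the theta side, for any sequence `T` obeying the functional equation
`T n = 1 - q^{2n-2m+1} T (n + 1)`. -/
theorem sum_thetaWeight_mul {q : ℂ} (hq0 : q ≠ 0) (hq : ‖q‖ < 1) (m : ℕ) (T : ℕ → ℂ)
    (hT : ∀ n, T n = 1 - q * (q ^ n) ^ 2 / (q ^ m) ^ 2 * T (n + 1)) :
    (1 - q ^ m) * q ^ m * ∑ n ∈ Finset.range (m + 1),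
        thetaWeight q m n * ((1 + q ^ n + q ^ n / q ^ m - (q ^ n) ^ 2 / q ^ m) / q ^ n) * T n
      = q ^ m * ∑ n ∈ Finset.range (m + 1),
        thetaWeight q m n * ((1 + q ^ n) * (1 - q ^ m / q ^ n)) := by
  have hQ : q ^ m ≠ 0 := pow_ne_zero _ hq0
  set g : ℕ → ℂ := fun n =>
    thetaWeight q m n * (1 - q ^ n) * (1 + q ^ m / q ^ n) * T n with hg
  have hstep : ∀ n ∈ Finset.range m,
      (1 - q ^ m) * q ^ m *
        (thetaWeight q m n * ((1 + q ^ n + q ^ n / q ^ m - (q ^ n) ^ 2 / q ^ m) / q ^ n) * T n)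
      = (g n - g (n + 1))
        + q ^ m * (thetaWeight q m n * ((1 + q ^ n) * (1 - q ^ m / q ^ n))) := by
    intro n hn
    have hx : q ^ n ≠ 0 := pow_ne_zero _ hq0
    have hw := thetaWeight_succ hq0 hq (Finset.mem_range.mp hn)
    have hg1 : g (n + 1) = thetaWeight q m n * (1 + q ^ n) * (1 - q ^ m / q ^ n)
        * (q ^ m * (1 - T n)) := by
      have h1 : q ^ m * g (n + 1) = thetaWeight q m n * (1 + q ^ n) * (1 - q ^ m / q ^ n)
          * (q * (q ^ n) ^ 2) * T (n + 1) := by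
        rw [← hw, hg]
        ring
      have h2 : q * (q ^ n) ^ 2 * T (n + 1) = (q ^ m) ^ 2 * (1 - T n) := by
        rw [hT n]
        field_simp
        ring
      apply mul_left_cancel₀ hQ
      rw [h1, mul_assoc _ (q * (q ^ n) ^ 2), h2]
      ring
    rw [hg1, hg]
    field_simp
    ring
  rw [Finset.mul_sum, Finset.mul_sum, Finset.sum_range_succ, Finset.sum_congr rfl hstep,
    Finset.sum_add_distrib, Finset.sum_range_sub', Finset.sum_range_succ _ m]
  -- `g 0 = 0`; at `n = m` one has `x = Q`, so the theta term is `g m` and the last right-hand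
  -- summand vanishes.
  simp only [hg, pow_zero, sub_self, mul_zero, zero_mul, div_self hQ]
  field_simp
  ring

theorem mainTheorem10 (q : ℂ) (hq0 : q ≠ 0) (hq1 : ‖q‖ < 1) (m : ℕ) (hm : 1 ≤ m) :
    (∀ n ∈ Finset.range (m + 1),
      Summable (partialThetaTerm (q ^ (2 * (n : ℤ) - 2 * (m : ℤ) + 1)) (q ^ 2))) ∧
    ∑ n ∈ Finset.range (m + 1),
        qPoch (-1) q n / qPoch (-q ^ (1 - (m : ℤ))) q n * qBinom q m n
          * q ^ ((3 * (n : ℤ) ^ 2 + (n : ℤ)) / 2 - 2 * (n : ℤ) * (m : ℤ))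
      = ∑ n ∈ Finset.range (m + 1),
        qPoch (-1) q n / qPoch (-q ^ (1 - (m : ℤ))) q n * qBinom q m n
          * q ^ ((3 * (n : ℤ) ^ 2 - (n : ℤ)) / 2 - 2 * (n : ℤ) * (m : ℤ))
          * (1 + q ^ (n : ℤ) + q ^ ((n : ℤ) - (m : ℤ)) - q ^ (2 * (n : ℤ) - (m : ℤ)))
          * partialTheta (q ^ (2 * (n : ℤ) - 2 * (m : ℤ) + 1)) (q ^ 2) := by
  have hq2 : ‖q ^ 2‖ < 1 := by
    rw [norm_pow]
    exact pow_lt_one₀ (norm_nonneg q) hq1 two_ne_zero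
  refine ⟨fun n _ => summable_partialThetaTerm _ _ hq2, ?_⟩
  have hQ : q ^ m ≠ 0 := pow_ne_zero _ hq0
  have hQ1 : 1 - q ^ m ≠ 0 := by
    have h := one_sub_pow_succ_ne_zero hq1 (m - 1)
    rwa [Nat.sub_add_cancel hm] at h
  set T : ℕ → ℂ := fun n => partialTheta (q ^ (2 * (n : ℤ) - 2 * (m : ℤ) + 1)) (q ^ 2) with hTdef
  have hT : ∀ n, T n = 1 - q * (q ^ n) ^ 2 / (q ^ m) ^ 2 * T (n + 1) := by
    intro n
    have h1 : q ^ (2 * (n : ℤ) - 2 * (m : ℤ) + 1) = q * (q ^ n) ^ 2 / (q ^ m) ^ 2 := by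
      rw [zpow_add₀ hq0, zpow_sub₀ hq0, mul_comm 2 (n : ℤ), mul_comm 2 (m : ℤ), zpow_mul,
        zpow_mul, zpow_one]
      norm_cast
      ring
    have h2 : q ^ (2 * (n : ℤ) - 2 * (m : ℤ) + 1) * q ^ 2
        = q ^ (2 * ((n + 1 : ℕ) : ℤ) - 2 * (m : ℤ) + 1) := by
      rw [← zpow_natCast q 2, ← zpow_add₀ hq0]
      congr 1
      push_cast
      ring
    simp only [hTdef]
    rw [partialTheta_eq_one_sub _ _ hq2, h2, h1]
  have hkey := sum_thetaWeight_mul hq0 hq1 m T hT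
  have hsplit : ∑ n ∈ Finset.range (m + 1),
        thetaWeight q m n * ((1 + q ^ n) * (1 - q ^ m / q ^ n))
      = (1 - q ^ m) * ∑ n ∈ Finset.range (m + 1), thetaWeight q m n := by
    rw [← add_zero ((1 - q ^ m) * _), ← sum_thetaWeight_antisymm hq0 m, Finset.mul_sum,
      ← Finset.sum_add_distrib]
    refine Finset.sum_congr rfl fun n _ => ?_
    have hx : q ^ n ≠ 0 := pow_ne_zero _ hq0
    field_simp
    ring
  have hsum : ∑ n ∈ Finset.range (m + 1), thetaWeight q m n
      = ∑ n ∈ Finset.range (m + 1),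
        thetaWeight q m n * ((1 + q ^ n + q ^ n / q ^ m - (q ^ n) ^ 2 / q ^ m) / q ^ n) * T n := by
    apply mul_left_cancel₀ (mul_ne_zero hQ1 hQ)
    rw [hkey, hsplit]
    ring
  rw [Finset.sum_congr rfl fun n hn =>
    summand_eq_thetaWeight hq0 hq1 (Finset.mem_range_succ_iff.mp hn), ← Finset.mul_sum, hsum,
    Finset.mul_sum]
  refine Finset.sum_congr rfl fun n hn => ?_
  have hx : q ^ n ≠ 0 := pow_ne_zero _ hq0
  have hs := summand_eq_thetaWeight hq0 hq1 (Finset.mem_range_succ_iff.mp hn)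
  have he : q ^ ((3 * (n : ℤ) ^ 2 - (n : ℤ)) / 2 - 2 * (n : ℤ) * (m : ℤ))
      = q ^ ((3 * (n : ℤ) ^ 2 + (n : ℤ)) / 2 - 2 * (n : ℤ) * (m : ℤ)) / q ^ n := by
    rw [← zpow_natCast q n, ← zpow_sub₀ hq0, three_mul_sq_add_self_ediv_two,
      three_mul_sq_sub_self_ediv_two]
    congr 1
    ring
  have hw : 1 + q ^ (n : ℤ) + q ^ ((n : ℤ) - (m : ℤ)) - q ^ (2 * (n : ℤ) - (m : ℤ))
      = 1 + q ^ n + q ^ n / q ^ m - (q ^ n) ^ 2 / q ^ m := by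
    rw [zpow_sub₀ hq0, zpow_sub₀ hq0, mul_comm 2 (n : ℤ), zpow_mul]
    norm_cast
  rw [he, hw, ← mul_assoc, ← mul_assoc, ← hs]
  ring
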